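/- Let $0 \le k < n$ be integers. A \emph{fibration of $\mathbb R^n$ by oriented affine $k$-planes} is an assignment to each $x \in \mathbb R^n$ of an oriented affine $k$-plane $P_x \subset \mathbb R^n$ containing $x$, such that $x \in P_y$ implies $P_y = P_x$ as oriented planes (so the planes partition $\mathbb R^n$), and such that $x \mapsto P_x$ is continuous into the oriented affine Grassmannian $AG_k(n)$ (here $P \in AG_k(n)$ is identified with the pair $(u,v)$, where $u$ is the parallel oriented linear $k$-plane, an element of the oriented Grassmannian $G_k(n)$, and $v \perp u$ is the point of $P$ nearest to the origin). The fibration is \emph{skew} if no two distinct fibers contain parallel lines. Two affine subspaces are called \emph{transverse} if their linear translates (directions) intersect only in $\{0\}$; they are not required to span $\mathbb R^n$. \textbf{Theorem.} For every skew fibration of $\mathbb R^n$ by oriented affine $k$-planes with $k < n$, there exists a linear subspace $V \subset \mathbb R^n$ of dimension $k+1$ that is transverse to all fibers. -/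

import Mathlib

/-- An element of the oriented Grassmannian `G_k(n)`: an oriented `k`-dimensional linear
subspace of Euclidean space `ℝⁿ`. -/
@[ext]
structure OrientedGrassmannian (k n : ℕ) where
  /-- The underlying linear subspace. -/
  plane : Submodule ℝ (EuclideanSpace ℝ (Fin n))
  /-- It has dimension `k`. -/
  finrank_plane : Module.finrank ℝ plane = k
  /-- The orientation of the subspace. -/
  orientation : Orientation ℝ plane (Fin k)

namespace OrientedGrassmannian

/-- Linearly independent `k`-frames in `ℝⁿ` (the noncompact Stiefel manifold), a subspace of
`(ℝⁿ)ᵏ`. -/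
abbrev Frame (k n : ℕ) : Type :=
  {f : Fin k → EuclideanSpace ℝ (Fin n) // LinearIndependent ℝ f}

/-- The span of a frame, oriented by the frame. -/
noncomputable def ofFrame {k n : ℕ} (f : Frame k n) : OrientedGrassmannian k n where
  plane := Submodule.span ℝ (Set.range f.1)
  finrank_plane := by
    simpa using finrank_span_eq_card f.2
  orientation := (Module.Basis.span f.2).orientation

/-- The topology of the oriented Grassmannian: the quotient topology from the space of frames.
(For `k = 0` the negatively oriented zero subspace is not the span of a frame, and this topology
is the discrete one on the two points.) -/
noncomputable instance (k n : ℕ) : TopologicalSpace (OrientedGrassmannian k n) :=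
  TopologicalSpace.coinduced ofFrame inferInstance

end OrientedGrassmannian

/-- The oriented affine Grassmannian `AG_k(n)`: an oriented affine `k`-plane `P` in `ℝⁿ` is
written as the pair `(u, v)`, where `u` is the oriented linear subspace parallel to `P` and `v`
is the point of `P` nearest to the origin, so that `v` is orthogonal to `u`. It carries the
subspace topology from `G_k(n) × ℝⁿ`. -/
abbrev OrientedAffineGrassmannian (k n : ℕ) : Type :=
  {P : OrientedGrassmannian k n × EuclideanSpace ℝ (Fin n) // P.2 ∈ (P.1.plane)ᗮ}

/-- The affine subspace `v + u` underlying the oriented affine plane `(u, v)`. -/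
noncomputable def OrientedAffineGrassmannian.toAffineSubspace {k n : ℕ}
    (P : OrientedAffineGrassmannian k n) : AffineSubspace ℝ (EuclideanSpace ℝ (Fin n)) :=
  AffineSubspace.mk' P.1.2 P.1.1.plane

/-- A (continuous) fibration of `ℝⁿ` by oriented affine `k`-planes: to each point `x` is
assigned the unique fiber through `x`, and the fiber depends continuously on `x`. -/
structure PlaneFibration (k n : ℕ) where
  /-- The oriented fiber through a point. -/
  fiber : EuclideanSpace ℝ (Fin n) → OrientedAffineGrassmannian k n
  /-- The fiber depends continuously on the point. -/
  continuous_fiber : Continuous fiber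
  /-- The fiber through `x` contains `x`. -/
  mem_fiber : ∀ x, x ∈ (fiber x).toAffineSubspace
  /-- The fiber through `x` is the only fiber that contains `x`. -/
  fiber_unique : ∀ x y, x ∈ (fiber y).toAffineSubspace → fiber y = fiber x

/-- Two affine subspaces contain parallel lines: a line in the first is parallel to a line in
the second. -/
def ContainParallelLines {n : ℕ} (A B : AffineSubspace ℝ (EuclideanSpace ℝ (Fin n))) : Prop :=
  ∃ l m : AffineSubspace ℝ (EuclideanSpace ℝ (Fin n)),
    Module.finrank ℝ l.direction = 1 ∧ Module.finrank ℝ m.direction = 1 ∧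
      l ≤ A ∧ m ≤ B ∧ l.Parallel m

/-- A fibration is skew if no two distinct fibers contain parallel lines. (Distinct fibers of a
fibration are disjoint in any case.) -/
def PlaneFibration.IsSkew {k n : ℕ} (F : PlaneFibration k n) : Prop :=
  ∀ x y, F.fiber x ≠ F.fiber y →
    ¬ ContainParallelLines (F.fiber x).toAffineSubspace (F.fiber y).toAffineSubspace

/-- Two affine subspaces are transverse if their linear translates meet only in the origin
(they need not span the whole space). -/
def AreTransverse {n : ℕ} (A B : AffineSubspace ℝ (EuclideanSpace ℝ (Fin n))) : Prop :=
  A.direction ⊓ B.direction = ⊥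

/-! ### Brouwer's fixed point theorem by change of variables. -/

section Brouwer

open MeasureTheory Polynomial Set Metric Filter Topology
open scoped NNReal

/-! Call the point of a fiber nearest to the origin its foot. The space `V` is a limit of the spans
of fibers whose feet go to infinity.

Such fibers exist (`exists_lt_norm_foot`). If all feet were bounded, one could move each foot by a
nonzero normal vector of its fiber and take the foot again; Brouwer gives a fixed point, hence a
fiber that contains a nonzero normal displacement of its own foot, which is absurd.

Skewness controls the fibration at infinity (`IsSkew.exists_dist_foot_lt_one`): if `d ≠ 0` is a
direction of a fiber `P`, then the fibers through remote points in directions near `d` have feet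
near that of `P`.

Let `V` be a limit of the linear spans `K j` of fibers with feet tending to infinity. If `V`
contained a nonzero direction `d` of a fiber `P`, then `d` or `-d` would be approached by directions
of remote points on these fibers. Their feet would then stay near the foot of `P`, yet they are
unbounded.

Brouwer's theorem comes from the integral of `φ (x + t • g x) * det (1 + t • Dg)` for a polynomial
`φ`: it is polynomial in `t` and constant for small `t`, hence constant. -/

theorem ContinuousLinearMap.det_one_add_pos_of_norm_lt_one {E : Type*} [NormedAddCommGroup E]
    [NormedSpace ℝ E] [FiniteDimensional ℝ E] (A : E →L[ℝ] E) (hA : ‖A‖ < 1) :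
    0 < (1 + A).det := by
  -- The determinant cannot vanish along the segment from `1` to `1 + A`, so it keeps the sign it
  -- has at `1`.
  have hne : ∀ s ∈ Icc (0 : ℝ) 1, (1 + s • A).det ≠ 0 := by
    intro s hs h0
    have hker : LinearMap.ker ((1 + s • A : E →L[ℝ] E) : E →ₗ[ℝ] E) ≠ ⊥ :=
      (LinearMap.bot_lt_ker_of_det_eq_zero h0).ne'
    obtain ⟨x, hx, hx0⟩ := (Submodule.ne_bot_iff _).1 hker
    have hx' : x = -(s • A x) := by
      have : x + s • A x = 0 := by simpa using hx
      exact eq_neg_of_add_eq_zero_left this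
    have h1 : ‖x‖ ≤ 1 * (‖A‖ * ‖x‖) := by
      calc ‖x‖ = ‖s‖ * ‖A x‖ := by conv_lhs => rw [hx', norm_neg, norm_smul]
        _ ≤ 1 * (‖A‖ * ‖x‖) := by
          gcongr
          · rw [Real.norm_eq_abs, abs_of_nonneg hs.1]; exact hs.2
          · exact A.le_opNorm x
    have : 0 < ‖x‖ := norm_pos_iff.2 hx0
    nlinarith
  have hcont : ContinuousOn (fun s : ℝ => (1 + s • A).det) (Icc 0 1) :=
    (ContinuousLinearMap.continuous_det.comp (by fun_prop)).continuousOn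
  by_contra! hneg
  have h0 : (1 + (0 : ℝ) • A).det = 1 := by
    simp [ContinuousLinearMap.det]
  obtain ⟨s, hs, hs0⟩ := intermediate_value_Icc' zero_le_one hcont
    (show (0 : ℝ) ∈ Icc _ _ from ⟨by simpa using hneg, by simp only [h0]; exact zero_le_one⟩)
  exact hne s hs hs0

theorem ContinuousLinearMap.exists_polynomial_eval_eq_det_one_add_smul {E : Type*}
    [NormedAddCommGroup E] [NormedSpace ℝ E] [FiniteDimensional ℝ E] (A : E →L[ℝ] E) :
    ∃ P : ℝ[X], P.natDegree ≤ Module.finrank ℝ E ∧ ∀ t, P.eval t = (1 + t • A).det := by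
  let b := Module.finBasis ℝ E
  let M := LinearMap.toMatrix b b (A : E →ₗ[ℝ] E)
  refine ⟨((X : ℝ[X]) • M.map C + (1 : Matrix _ _ ℝ).map C).det, ?_, fun t => ?_⟩
  · simpa using natDegree_det_X_add_C_le M 1
  · have h : (1 + t • A).det = (1 + t • M).det := by
      change LinearMap.det ((1 + t • A : E →L[ℝ] E) : E →ₗ[ℝ] E) = _
      rw [← LinearMap.det_toMatrix b]
      congr 1
      have : ((1 + t • A : E →L[ℝ] E) : E →ₗ[ℝ] E) = LinearMap.id + t • (A : E →ₗ[ℝ] E) := rfl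
      rw [this, map_add, map_smul, LinearMap.toMatrix_id]
    rw [h, ← coe_evalRingHom, RingHom.map_det]
    congr 1
    ext i j
    by_cases hij : i = j
    · subst hij; simp [Matrix.map_apply]; ring
    · simp [Matrix.map_apply, hij]; ring

theorem LipschitzWith.bijective_id_add {E : Type*} [NormedAddCommGroup E] [NormedSpace ℝ E]
    [CompleteSpace E] {K : ℝ≥0} {g : E → E} (hg : LipschitzWith K g) (hK : K < 1) :
    Function.Bijective fun x => x + g x := by
  have happ : ApproximatesLinearOn (fun x => x + g x)
      ((ContinuousLinearEquiv.refl ℝ E : E ≃L[ℝ] E) : E →L[ℝ] E) univ K := by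
    intro x _ y _
    have h := hg.norm_sub_le x y
    simpa [add_sub_add_comm] using h
  have hc : Subsingleton E ∨
      K < ‖((ContinuousLinearEquiv.refl ℝ E).symm : E →L[ℝ] E)‖₊⁻¹ := by
    rcases subsingleton_or_nontrivial E with h | h
    · exact Or.inl h
    · right
      have : ‖((ContinuousLinearEquiv.refl ℝ E).symm : E →L[ℝ] E)‖₊ = 1 := by
        ext
        exact ContinuousLinearMap.norm_id
      rw [this]; simpa using hK
  exact (happ.toHomeomorph _ hc).bijective

variable {E : Type*} [NormedAddCommGroup E] [InnerProductSpace ℝ E] [FiniteDimensional ℝ E]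
  [MeasurableSpace E] [BorelSpace E]

/-- A contractive `g` makes `x + g x` a bijection with positive Jacobian. It fixes the complement of
`s` pointwise, so it maps `s` onto itself. -/
theorem setIntegral_comp_id_add_mul_det_of_lipschitzWith {K : ℝ≥0} {g : E → E} {s : Set E}
    (hs : MeasurableSet s) (hg : ContDiff ℝ 1 g) (hK : LipschitzWith K g) (hK1 : K < 1)
    (hsupp : ∀ x ∉ s, g x = 0) (φ : E → ℝ) :
    ∫ x in s, φ (x + g x) * (1 + fderiv ℝ g x).det = ∫ x in s, φ x := by
  have hbij := hK.bijective_id_add hK1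
  have himage : (fun x => x + g x) '' s = s := by
    have hcompl : (fun x => x + g x) '' sᶜ = sᶜ := by
      conv_rhs => rw [← image_id sᶜ]
      exact image_congr fun x hx => by simp [hsupp x hx]
    rw [image_compl_eq hbij, compl_inj_iff] at hcompl
    exact hcompl
  have hderiv : ∀ x ∈ s, HasFDerivWithinAt (fun x => x + g x) (1 + fderiv ℝ g x) s x := by
    intro x _
    exact ((hasFDerivAt_id x).add
      (hg.differentiable (by simp) x).hasFDerivAt).hasFDerivWithinAt
  have h := integral_image_eq_integral_abs_det_fderiv_smul volume hs hderiv hbij.1.injOn φ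
  rw [himage] at h
  rw [h]
  refine integral_congr_ae (Eventually.of_forall fun x => ?_)
  have hpos : 0 < (1 + fderiv ℝ g x).det :=
    ContinuousLinearMap.det_one_add_pos_of_norm_lt_one _
      ((norm_fderiv_le_of_lipschitz ℝ hK).trans_lt (by exact_mod_cast hK1))
  simp only [abs_of_pos hpos, smul_eq_mul, mul_comm]

/-- If the value of an integrand is a polynomial of bounded degree in a parameter, and the
integral has a constant value for all small parameters, then it has this value everywhere. -/
theorem integral_eq_of_polynomial_of_eventually {α : Type*} [MeasurableSpace α] {μ : Measure α}
    {f : ℝ → α → ℝ} {d : ℕ} (hint : ∀ t, Integrable (f t) μ)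
    (hpoly : ∀ x, ∃ P : ℝ[X], P.natDegree ≤ d ∧ ∀ t, P.eval t = f t x) {c ε : ℝ} (hε : 0 < ε)
    (hc : ∀ t, 0 < t → t < ε → ∫ x, f t x ∂μ = c) (t : ℝ) : ∫ x, f t x ∂μ = c := by
  -- Interpolation nodes strictly between `0` and `ε`. Lagrange's formula writes the integrand at
  -- `t` as a fixed combination of its values at the nodes, which avoids integrating coefficients.
  let v : ℕ → ℝ := fun i => ε / (i + 2)
  have hv : InjOn v (Finset.range (d + 1)) := by
    intro i _ j _ hij
    have hi : (0 : ℝ) < i + 2 := by positivity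
    have hj : (0 : ℝ) < j + 2 := by positivity
    have : ε * (j + 2) = ε * (i + 2) := by
      simpa [v, div_eq_div_iff hi.ne' hj.ne'] using hij
    have := mul_left_cancel₀ hε.ne' this
    have : (i : ℝ) = j := by linarith
    exact_mod_cast this
  have hvc : ∀ i, ∫ x, f (v i) x ∂μ = c := fun i => by
    have hi : (0 : ℝ) < i + 2 := by positivity
    refine hc _ (by positivity) ?_
    rw [div_lt_iff₀ hi]
    nlinarith [(Nat.cast_nonneg i : (0 : ℝ) ≤ i)]
  have hsum : ∀ x, f t x = ∑ i ∈ Finset.range (d + 1),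
      f (v i) x * (Lagrange.basis (Finset.range (d + 1)) v i).eval t := by
    intro x
    obtain ⟨P, hPd, hP⟩ := hpoly x
    have hdeg : P.degree < (Finset.range (d + 1)).card := by
      rw [Finset.card_range]
      exact degree_le_natDegree.trans_lt (WithBot.coe_lt_coe.2 (Nat.lt_succ_of_le hPd))
    have h := Lagrange.eq_interpolate hv hdeg
    rw [← hP t, h, Lagrange.interpolate_apply, eval_finsetSum]
    simp [hP]
  simp_rw [hsum]
  rw [integral_finsetSum _ fun i _ => (hint _).mul_const _]
  simp_rw [integral_mul_const, hvc]
  rw [← Finset.mul_sum, ← eval_finsetSum, Lagrange.sum_basis hv ⟨0, by simp⟩]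
  simp

/-- Replace `g` by `t • g`: the integrand is polynomial in `t`, and for small `t` the map `t • g` is
contractive, so the change of variables applies. The case `t = 1` follows. -/
theorem setIntegral_closedBall_pow_mul_det {g : E → E} {r L : ℝ} (hg : ContDiff ℝ 1 g)
    (hgc : HasCompactSupport g) (hsupp : ∀ x ∉ closedBall (0 : E) r, g x = 0) (N : ℕ) :
    ∫ x in closedBall (0 : E) r,
        (1 - ‖x + g x‖ ^ 2 / L ^ 2) ^ N * (1 + fderiv ℝ g x).det =
      ∫ x in closedBall (0 : E) r, (1 - ‖x‖ ^ 2 / L ^ 2) ^ N := by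
  obtain ⟨K, hK⟩ := hg.lipschitzWith_of_hasCompactSupport hgc one_ne_zero
  have hdc : Continuous (fderiv ℝ g) := hg.continuous_fderiv one_ne_zero
  have hgcont := hg.continuous
  have key := integral_eq_of_polynomial_of_eventually
    (μ := volume.restrict (closedBall (0 : E) r))
    (f := fun t x => (1 - ‖x + t • g x‖ ^ 2 / L ^ 2) ^ N * (1 + t • fderiv ℝ g x).det)
    (d := N * 2 + Module.finrank ℝ E) (c := ∫ x in closedBall (0 : E) r, (1 - ‖x‖ ^ 2 / L ^ 2) ^ N)
    (ε := 1 / (K + 1)) ?_ ?_ (by positivity) ?_ 1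
  · simpa using key
  · intro t
    have : Continuous fun x => (1 - ‖x + t • g x‖ ^ 2 / L ^ 2) ^ N *
        (1 + t • fderiv ℝ g x).det :=
      Continuous.mul (by fun_prop) (ContinuousLinearMap.continuous_det.comp (by fun_prop))
    exact this.continuousOn.integrableOn_compact (isCompact_closedBall _ _)
  · intro x
    obtain ⟨P, hPd, hP⟩ := (fderiv ℝ g x).exists_polynomial_eval_eq_det_one_add_smul
    let Q : ℝ[X] := C (1 - ‖x‖ ^ 2 / L ^ 2) + C (-(2 * inner ℝ x (g x)) / L ^ 2) * X +
      C (-‖g x‖ ^ 2 / L ^ 2) * X ^ 2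
    have hQ : Q.natDegree ≤ 2 := by
      simp only [Q]; compute_degree
    refine ⟨Q ^ N * P, ?_, fun t => ?_⟩
    · refine natDegree_mul_le.trans (add_le_add (natDegree_pow_le.trans ?_) hPd)
      gcongr
    · rw [eval_mul, eval_pow, hP, norm_add_sq_real, inner_smul_right, norm_smul, mul_pow,
        Real.norm_eq_abs, sq_abs]
      congr 2
      simp only [Q, eval_add, eval_mul, eval_C, eval_X, eval_pow]
      ring
  · intro t ht htε
    have hd : ∀ x, fderiv ℝ (t • g) x = t • fderiv ℝ g x := fun x => by
      rw [fderiv_const_smul (hg.differentiable one_ne_zero x)]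
    have hlip : LipschitzWith (t.toNNReal * K) (t • g) := by
      refine LipschitzWith.of_dist_le_mul fun x y => ?_
      rw [Pi.smul_apply, Pi.smul_apply, dist_smul₀, NNReal.coe_mul, Real.coe_toNNReal _ ht.le,
        Real.norm_eq_abs, abs_of_pos ht, mul_assoc]
      exact mul_le_mul_of_nonneg_left (hK.dist_le_mul x y) ht.le
    have hlt : t.toNNReal * K < 1 := by
      rw [← NNReal.coe_lt_coe]
      have hK0 : (0 : ℝ) ≤ K := K.2
      rw [lt_div_iff₀ (by positivity)] at htε
      rw [NNReal.coe_mul, Real.coe_toNNReal _ ht.le]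
      push_cast
      nlinarith
    have h := setIntegral_comp_id_add_mul_det_of_lipschitzWith
      (measurableSet_closedBall (x := (0 : E)) (ε := r)) (hg.const_smul t) hlip hlt
      (fun x hx => by simp [hsupp x hx]) (fun y => (1 - ‖y‖ ^ 2 / L ^ 2) ^ N)
    rw [← h]
    refine integral_congr_ae (Eventually.of_forall fun x => ?_)
    change _ = _ * (1 + fderiv ℝ (t • g) x).det
    rw [hd]

/-- If `x + g x` stays at distance at least `δ` from `0`, the integral with exponent `N` is at most
`a ^ N * D`. The equal integral without `g` sees the ball of radius `δ / 2` and is at least `b ^ N *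
c` with `b > a`; large `N` gives a contradiction. -/
theorem exists_add_eq_zero_of_hasCompactSupport {g : E → E} (hg : ContDiff ℝ 1 g)
    (hgc : HasCompactSupport g) : ∃ x, x + g x = 0 := by
  by_contra! hne
  have hgcont := hg.continuous
  have hdc : Continuous (fderiv ℝ g) := hg.continuous_fderiv one_ne_zero
  obtain ⟨r, hr0, hr⟩ := hgc.isCompact.isBounded.subset_closedBall_lt 0 0
  have hsupp : ∀ x ∉ closedBall (0 : E) r, g x = 0 := fun x hx =>
    image_eq_zero_of_notMem_tsupport fun h => hx (hr h)
  have hBc : IsCompact (closedBall (0 : E) r) := isCompact_closedBall _ _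
  have hBne : (closedBall (0 : E) r).Nonempty := ⟨0, by simp [hr0.le]⟩
  have hcont : Continuous fun x => ‖x + g x‖ := by fun_prop
  obtain ⟨x₀, -, hx₀⟩ := hBc.exists_isMinOn hBne hcont.continuousOn
  obtain ⟨x₁, -, hx₁⟩ := hBc.exists_isMaxOn hBne hcont.continuousOn
  let δ : ℝ := min r ‖x₀ + g x₀‖
  have hδ : 0 < δ := lt_min hr0 (norm_pos_iff.2 (hne x₀))
  have hδr : δ ≤ r := min_le_left _ _
  -- This choice keeps the bases of both powers nonnegative on the ball.
  let L : ℝ := max r ‖x₁ + g x₁‖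
  have hrL : r ≤ L := le_max_left _ _
  have hL : 0 < L := hr0.trans_le hrL
  let a : ℝ := 1 - δ ^ 2 / L ^ 2
  let b : ℝ := 1 - (δ / 2) ^ 2 / L ^ 2
  have ha : 0 ≤ a := by
    have : δ ^ 2 / L ^ 2 ≤ 1 := by
      rw [div_le_one (by positivity)]
      gcongr
      exact hδr.trans hrL
    simp only [a]; linarith
  have hab : a < b := by
    have : (δ / 2) ^ 2 / L ^ 2 < δ ^ 2 / L ^ 2 := by
      gcongr
      linarith
    simp only [a, b]; linarith
  have hb : 0 < b := ha.trans_lt hab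
  have hdetc : Continuous fun x => (1 + fderiv ℝ g x).det :=
    ContinuousLinearMap.continuous_det.comp (by fun_prop)
  let D : ℝ := ∫ x in closedBall (0 : E) r, |(1 + fderiv ℝ g x).det|
  let c : ℝ := volume.real (closedBall (0 : E) (δ / 2))
  have hc : 0 < c :=
    ENNReal.toReal_pos (measure_closedBall_pos _ _ (by positivity)).ne'
      measure_closedBall_lt_top.ne
  have hupper : ∀ N : ℕ, ∫ x in closedBall (0 : E) r,
      (1 - ‖x + g x‖ ^ 2 / L ^ 2) ^ N * (1 + fderiv ℝ g x).det ≤ a ^ N * D := by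
    intro N
    simp only [D]
    rw [← integral_const_mul]
    refine setIntegral_mono_on ?_ ?_ measurableSet_closedBall fun x hx => ?_
    · exact (Continuous.mul (by fun_prop) hdetc).continuousOn.integrableOn_compact hBc
    · exact (hdetc.abs.const_smul (a ^ N)).continuousOn.integrableOn_compact hBc
    · have h1 : δ ≤ ‖x + g x‖ := (min_le_right _ _).trans (hx₀ hx)
      have h2 : ‖x + g x‖ ≤ L := (hx₁ hx).trans (le_max_right _ _)
      have h3 : 0 ≤ 1 - ‖x + g x‖ ^ 2 / L ^ 2 := by
        have : ‖x + g x‖ ^ 2 / L ^ 2 ≤ 1 := by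
          rw [div_le_one (by positivity)]
          gcongr
        linarith
      have h4 : 1 - ‖x + g x‖ ^ 2 / L ^ 2 ≤ a := by
        simp only [a]
        gcongr
      calc _ ≤ (1 - ‖x + g x‖ ^ 2 / L ^ 2) ^ N * |(1 + fderiv ℝ g x).det| := by
            gcongr
            exact le_abs_self _
        _ ≤ _ := by gcongr
  have hlower : ∀ N : ℕ, b ^ N * c ≤
      ∫ x in closedBall (0 : E) r, (1 - ‖x‖ ^ 2 / L ^ 2) ^ N := by
    intro N
    have hpc : Continuous fun x : E => (1 - ‖x‖ ^ 2 / L ^ 2) ^ N := by fun_prop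
    have hnn : ∀ x ∈ closedBall (0 : E) r, 0 ≤ (1 - ‖x‖ ^ 2 / L ^ 2) ^ N := by
      intro x hx
      have hx' : ‖x‖ ≤ L := (mem_closedBall_zero_iff.1 hx).trans hrL
      have : ‖x‖ ^ 2 / L ^ 2 ≤ 1 := by
        rw [div_le_one (by positivity)]
        gcongr
      exact pow_nonneg (by linarith) _
    calc b ^ N * c = ∫ x in closedBall (0 : E) (δ / 2), b ^ N := by
          simp [c, mul_comm]
      _ ≤ ∫ x in closedBall (0 : E) (δ / 2), (1 - ‖x‖ ^ 2 / L ^ 2) ^ N := by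
          refine setIntegral_mono_on ?_ ?_ measurableSet_closedBall fun x hx => ?_
          · exact continuous_const.continuousOn.integrableOn_compact (isCompact_closedBall _ _)
          · exact hpc.continuousOn.integrableOn_compact (isCompact_closedBall _ _)
          · have hx' : ‖x‖ ≤ δ / 2 := mem_closedBall_zero_iff.1 hx
            simp only [b]
            gcongr
      _ ≤ _ := by
          refine setIntegral_mono_set (hpc.continuousOn.integrableOn_compact hBc) ?_ ?_
          · exact (ae_restrict_iff' measurableSet_closedBall).2 (Eventually.of_forall hnn)
          · exact (closedBall_subset_closedBall (by linarith)).eventuallyLE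
  have hle : ∀ N : ℕ, c ≤ (a / b) ^ N * D := by
    intro N
    have h := (hlower N).trans
      ((setIntegral_closedBall_pow_mul_det (L := L) hg hgc hsupp N).symm.le.trans (hupper N))
    rw [div_pow, div_mul_eq_mul_div, le_div_iff₀ (by positivity)]
    linarith
  have hlim : Tendsto (fun N : ℕ => (a / b) ^ N * D) atTop (𝓝 (0 * D)) :=
    (tendsto_pow_atTop_nhds_zero_of_lt_one (by positivity) ((div_lt_one hb).2 hab)).mul_const D
  have := ge_of_tendsto' hlim hle
  linarith

/-- **Brouwer's fixed point theorem**, for a bounded continuous self-map of a Euclidean space. -/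
theorem exists_isFixedPt_of_continuous_of_bounded {E : Type*} [NormedAddCommGroup E]
    [InnerProductSpace ℝ E] [FiniteDimensional ℝ E] {f : E → E} (hf : Continuous f) {R : ℝ}
    (hR : ∀ x, ‖f x‖ ≤ R) : ∃ x, f x = x := by
  borelize E
  by_contra! hne
  have hR0 : 0 ≤ R := (norm_nonneg _).trans (hR 0)
  have hcont : Continuous fun x => ‖f x - x‖ := by fun_prop
  obtain ⟨x₀, -, hx₀⟩ := (isCompact_closedBall (0 : E) (R + 1)).exists_isMinOn
    ⟨0, by simp; linarith⟩ hcont.continuousOn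
  let δ : ℝ := min 1 ‖f x₀ - x₀‖
  have hδ : 0 < δ := lt_min one_pos (norm_pos_iff.2 (sub_ne_zero.2 (hne x₀)))
  obtain ⟨G, hG, hGf, -⟩ := hf.exists_contDiff_approx 1 (ε := fun _ => δ) continuous_const
    fun _ => hδ
  have hGR : ∀ x, ‖G x‖ ≤ R + 1 := fun x => by
    have h1 : ‖G x - f x‖ < δ := by simpa [dist_eq_norm] using hGf x
    have h2 := norm_le_norm_add_norm_sub' (G x) (f x)
    have h3 : δ ≤ 1 := min_le_left _ _
    linarith [hR x]
  -- A zero of `x - χ x • G x` has norm at most `R + 1`, where `χ = 1`, so it is a fixed point of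
  -- `G`.
  let χ : ContDiffBump (0 : E) := ⟨R + 1, R + 2, by linarith, by linarith⟩
  obtain ⟨x, hx⟩ := exists_add_eq_zero_of_hasCompactSupport (g := fun x => -(χ x • G x))
    ((χ.contDiff.smul hG).neg) (χ.hasCompactSupport.smul_right.neg)
  have hx' : x = χ x • G x := by simpa [add_neg_eq_zero] using hx
  have hxR : x ∈ closedBall (0 : E) (R + 1) := by
    rw [mem_closedBall_zero_iff, hx', norm_smul, Real.norm_eq_abs, abs_of_nonneg χ.nonneg]
    exact (mul_le_of_le_one_left (norm_nonneg _) χ.le_one).trans (hGR x)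
  rw [χ.one_of_mem_closedBall hxR, one_smul] at hx'
  have h1 : ‖f x - x‖ < δ := by
    have := hGf x
    rwa [← hx', dist_comm, dist_eq_norm] at this
  exact absurd ((min_le_right _ _).trans (hx₀ hxR)) (not_le.2 h1)

end Brouwer

/-! ### Fibrations without orientation, and unboundedness of the feet. -/

section OrthogonalFibration

open Set Metric Filter Topology Module

/-- A partition of a Euclidean space into affine subspaces, given by the direction `dir x` of the
fiber through `x` and its point `foot x` nearest to the origin, both continuous in `x`. -/
structure OrthogonalFibration (E : Type*) [NormedAddCommGroup E] [InnerProductSpace ℝ E]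
    [FiniteDimensional ℝ E] where
  dir : E → Submodule ℝ E
  foot : E → E
  continuous_starProjection : Continuous fun x => (dir x).starProjection
  continuous_foot : Continuous foot
  foot_mem_orthogonal : ∀ x, foot x ∈ (dir x)ᗮ
  sub_foot_mem : ∀ x, x - foot x ∈ dir x
  eq_of_sub_foot_mem : ∀ x y, x - foot y ∈ dir y → dir x = dir y ∧ foot x = foot y

variable {E : Type*} [NormedAddCommGroup E] [InnerProductSpace ℝ E] [FiniteDimensional ℝ E]

/-- A continuous family of proper subspaces has a continuous nonvanishing normal field over a
ball. -/
theorem exists_continuous_mem_orthogonal_ne_zero {u : E → Submodule ℝ E}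
    (hu : Continuous fun x => (u x).starProjection) (h0 : u 0 ≠ ⊤) (R : ℝ) :
    ∃ N : E → E, Continuous N ∧ ∀ x, ‖x‖ ≤ R → N x ∈ (u x)ᗮ ∧ N x ≠ 0 := by
  have huc : UniformContinuousOn (fun x => (u x).starProjection) (closedBall 0 R) :=
    (isCompact_closedBall _ _).uniformContinuousOn_of_continuous hu.continuousOn
  obtain ⟨δ, hδ, hδu⟩ := Metric.uniformContinuousOn_iff.1 huc 1 one_pos
  -- The normal field is extended outward in steps of `δ / 2`: pull it back by a contraction and
  -- project to the new normal space. Projections at points closer than `δ` differ by less than `1`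
  -- in norm, so a nonzero normal vector is not killed.
  have step : ∀ j : ℕ, ∃ N : E → E, Continuous N ∧
      ∀ x, ‖x‖ ≤ R → ‖x‖ ≤ j * (δ / 2) → N x ∈ (u x)ᗮ ∧ N x ≠ 0 := by
    intro j
    induction j with
    | zero =>
      have : (u 0)ᗮ ≠ ⊥ := fun h => h0 ((Submodule.orthogonal_eq_bot_iff).1 h)
      obtain ⟨w, hw, hw0⟩ := (Submodule.ne_bot_iff _).1 this
      refine ⟨fun _ => w, continuous_const, fun x _ hx => ?_⟩
      have : x = 0 := by simpa using hx
      exact ⟨this ▸ hw, hw0⟩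
    | succ j ih =>
      obtain ⟨N, hN, hNx⟩ := ih
      let c : ℝ := j / (j + 1)
      have hj : (0 : ℝ) < j + 1 := by positivity
      have hc0 : 0 ≤ c := by positivity
      have hc1 : c ≤ 1 := (div_le_one hj).2 (by linarith)
      refine ⟨fun x => N (c • x) - (u x).starProjection (N (c • x)), ?_, fun x hxR hx => ?_⟩
      · exact (hN.comp (by fun_prop)).sub (hu.clm_apply (hN.comp (by fun_prop)))
      · refine ⟨Submodule.sub_starProjection_mem_orthogonal _, fun hzero => ?_⟩
        have hcx : ‖c • x‖ = c * ‖x‖ := by rw [norm_smul, Real.norm_eq_abs, abs_of_nonneg hc0]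
        have hcR : ‖c • x‖ ≤ R := by
          rw [hcx]; exact (mul_le_of_le_one_left (norm_nonneg _) hc1).trans hxR
        have hcj : ‖c • x‖ ≤ j * (δ / 2) := by
          rw [hcx]
          calc c * ‖x‖ ≤ c * ((j + 1) * (δ / 2)) := by gcongr; exact_mod_cast hx
            _ = j * (δ / 2) := by simp only [c]; field_simp
        obtain ⟨hmem, hne⟩ := hNx _ hcR hcj
        have hdist : dist x (c • x) < δ := by
          have h1 : x - c • x = (1 - c) • x := by rw [sub_smul, one_smul]
          rw [dist_eq_norm, h1, norm_smul, Real.norm_eq_abs, abs_of_nonneg (by linarith)]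
          calc (1 - c) * ‖x‖ ≤ (1 - c) * ((j + 1) * (δ / 2)) := by
                refine mul_le_mul_of_nonneg_left ?_ (sub_nonneg.2 hc1)
                exact_mod_cast hx
            _ = δ / 2 := by simp only [c]; field_simp; ring
            _ < δ := by linarith
        have hlt := hδu x (by simpa using hxR) (c • x) (by simpa using hcR) hdist
        have hz : (u (c • x)).starProjection (N (c • x)) = 0 :=
          (Submodule.starProjection_apply_eq_zero_iff _).2 hmem
        have hx1 : ((u x).starProjection - (u (c • x)).starProjection) (N (c • x)) =
            N (c • x) := by
          rw [sub_apply, hz, sub_zero]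
          exact (sub_eq_zero.1 hzero).symm
        have hle := ((u x).starProjection - (u (c • x)).starProjection).le_opNorm (N (c • x))
        rw [hx1] at hle
        rw [dist_eq_norm] at hlt
        have : 0 < ‖N (c • x)‖ := norm_pos_iff.2 hne
        nlinarith
  obtain ⟨j, hj⟩ := exists_nat_ge (R / (δ / 2))
  obtain ⟨N, hN, hNx⟩ := step j
  refine ⟨N, hN, fun x hx => hNx x hx (hx.trans ?_)⟩
  rwa [div_le_iff₀ (by positivity)] at hj

/-- The limit is idempotent, and the rank of an idempotent is its trace, which is continuous. -/
theorem Submodule.exists_finrank_eq_of_tendsto_starProjection {K : ℕ → Submodule ℝ E} {m : ℕ}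
    (hK : ∀ i, finrank ℝ (K i) = m) {T : E →L[ℝ] E}
    (hT : Tendsto (fun i => (K i).starProjection) atTop (𝓝 T)) :
    ∃ V : Submodule ℝ E, finrank ℝ V = m ∧ ∀ d ∈ V, T d = d := by
  have hidem : IsIdempotentElem T := by
    refine tendsto_nhds_unique ((hT.mul hT).congr fun i => ?_) hT
    exact (K i).isIdempotentElem_starProjection
  have hidem' : IsIdempotentElem (T : E →ₗ[ℝ] E) := by
    ext x
    exact congrArg (fun S : E →L[ℝ] E => S x) hidem
  have htr : Continuous fun S : E →L[ℝ] E => LinearMap.trace ℝ E (S : E →ₗ[ℝ] E) :=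
    LinearMap.continuous_of_finiteDimensional
      ((LinearMap.trace ℝ E).comp (ContinuousLinearMap.coeLM ℝ))
  have hi : ∀ i, LinearMap.trace ℝ E ((K i).starProjection : E →ₗ[ℝ] E) = m := fun i => by
    have h : LinearMap.IsProj (K i) ((K i).starProjection : E →ₗ[ℝ] E) :=
      ⟨fun x => Submodule.starProjection_apply_mem _ x,
        fun x hx => Submodule.starProjection_eq_self_iff.2 hx⟩
    rw [h.trace, hK]
  have hproj := LinearMap.IsIdempotentElem.isProj_range _ hidem'
  have hlim := tendsto_nhds_unique ((htr.tendsto T).comp hT)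
    (tendsto_const_nhds.congr fun i => (hi i).symm)
  rw [hproj.trace] at hlim
  exact ⟨_, by exact_mod_cast hlim, fun d hd => hproj.map_id d hd⟩

namespace OrthogonalFibration

variable (F : OrthogonalFibration E)

theorem foot_foot (x : E) : F.foot (F.foot x) = F.foot x :=
  (F.eq_of_sub_foot_mem _ _ (by simp)).2

theorem dir_foot (x : E) : F.dir (F.foot x) = F.dir x :=
  (F.eq_of_sub_foot_mem _ _ (by simp)).1

theorem exists_lt_norm_foot (h0 : F.dir 0 ≠ ⊤) (R : ℝ) : ∃ x, R < ‖F.foot x‖ := by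
  by_contra! hR
  have hR0 : 0 ≤ R := (norm_nonneg _).trans (hR 0)
  obtain ⟨N, hN, hNx⟩ := exists_continuous_mem_orthogonal_ne_zero F.continuous_starProjection h0
    (R + 1)
  -- Radial retraction onto the ball where `N` is a nonvanishing normal field.
  let c : E → E := fun x => ((R + 1) / max (R + 1) ‖x‖) • x
  have hc : Continuous c := by
    refine Continuous.smul (Continuous.div continuous_const (by fun_prop) fun x => ?_)
      continuous_id
    exact (lt_max_of_lt_left (by linarith)).ne'
  have hf : Continuous fun x => F.foot (F.foot (c x) + N (c x)) :=
    F.continuous_foot.comp ((F.continuous_foot.comp hc).add (hN.comp hc))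
  obtain ⟨x, hx⟩ := exists_isFixedPt_of_continuous_of_bounded hf (R := R) fun x => hR _
  have hxR : ‖x‖ ≤ R + 1 := by
    rw [← hx]; exact (hR _).trans (by linarith)
  have hcx : c x = x := by
    simp only [c]
    rw [max_eq_left hxR, div_self (by linarith), one_smul]
  rw [hcx] at hx
  -- The fixed point is a foot, and the fiber through `x + N x` has the same foot, so it is the
  -- fiber through `x`.
  have hfx : F.foot x = x := by
    rw [← hx, F.foot_foot]
  have hdx : F.dir (F.foot x + N x) = F.dir x := by
    rw [← F.dir_foot, hx]
  have hmem := F.sub_foot_mem (F.foot x + N x)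
  rw [hx, hdx, hfx, add_sub_cancel_left] at hmem
  obtain ⟨h1, h2⟩ := hNx x hxR
  exact h2 (Submodule.disjoint_def.1 (F.dir x).orthogonal_disjoint _ hmem h1)

/-- The fibration is skew: distinct fibers share no nonzero direction. -/
def IsSkew : Prop := ∀ x y d, d ≠ 0 → d ∈ F.dir x → d ∈ F.dir y → F.foot x = F.foot y

/-! ### Skew fibrations at infinity, and the limit subspace. -/

variable {F}

/-- Otherwise, as the points go to infinity, feet on the compact unit sphere around `F.foot x`
accumulate at a foot `y`. Then `d` lies in `F.dir y`, and skewness forces `y = F.foot x`. -/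
theorem IsSkew.exists_dist_foot_ne_one (hF : F.IsSkew) {x d : E} (hd : d ∈ F.dir x)
    (hd0 : d ≠ 0) :
    ∃ ε > 0, ∀ (s : ℝ) (e : E), 0 < s → s < ε → dist e d < ε →
      dist (F.foot (s⁻¹ • e)) (F.foot x) ≠ 1 := by
  by_contra! h
  choose s e hs hsε heε hdist using fun j : ℕ => h (1 / ((j : ℝ) + 1)) (by positivity)
  obtain ⟨y, hy, φ, hφ, hlim⟩ := (isCompact_sphere (F.foot x) 1).tendsto_subseq
    (x := fun j => F.foot ((s j)⁻¹ • e j)) fun j => mem_sphere.2 (hdist j)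
  have hs0 : Tendsto s atTop (𝓝 0) :=
    squeeze_zero (fun j => (hs j).le) (fun j => (hsε j).le) tendsto_one_div_add_atTop_nhds_zero_nat
  have he : Tendsto e atTop (𝓝 d) :=
    tendsto_iff_dist_tendsto_zero.2 <| squeeze_zero (fun j => dist_nonneg)
      (fun j => (heε j).le) tendsto_one_div_add_atTop_nhds_zero_nat
  have hfy : F.foot y = y := by
    refine tendsto_nhds_unique ((F.continuous_foot.tendsto y).comp hlim) (hlim.congr fun j => ?_)
    exact (F.foot_foot _).symm
  -- Rescaled by `s j`, the foot stays bounded and contributes nothing in the limit.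
  have hmem : ∀ j, e j - s j • F.foot ((s j)⁻¹ • e j) ∈ F.dir (F.foot ((s j)⁻¹ • e j)) := by
    intro j
    have h1 := Submodule.smul_mem _ (s j) (F.sub_foot_mem ((s j)⁻¹ • e j))
    rw [smul_sub, smul_smul, mul_inv_cancel₀ (hs j).ne', one_smul] at h1
    rwa [F.dir_foot]
  have hlim1 : Tendsto (fun j => e (φ j) - s (φ j) • F.foot ((s (φ j))⁻¹ • e (φ j))) atTop
      (𝓝 d) := by
    have := (he.comp hφ.tendsto_atTop).sub ((hs0.comp hφ.tendsto_atTop).smul hlim)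
    simpa using this
  have hjoint : Continuous fun p : E × E => (F.dir p.1).starProjection p.2 :=
    (F.continuous_starProjection.comp continuous_fst).clm_apply continuous_snd
  have hlim2 := (hjoint.tendsto (y, d)).comp (hlim.prodMk_nhds hlim1)
  have hdy : (F.dir y).starProjection d = d := by
    refine tendsto_nhds_unique hlim2 (hlim1.congr fun j => ?_)
    exact (Submodule.starProjection_eq_self_iff.2 (hmem (φ j))).symm
  have := hF x y d hd0 hd (Submodule.starProjection_eq_self_iff.1 hdy)
  rw [hfy] at this
  rw [this, mem_sphere, dist_self] at hy
  exact zero_ne_one hy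

/-- The pairs `(s, e)` form a connected set on which the distance never equals `1`, and it is `0` at
a pair representing a point of the fiber through `x`. -/
theorem IsSkew.exists_dist_foot_lt_one (hF : F.IsSkew) {x d : E} (hd : d ∈ F.dir x)
    (hd0 : d ≠ 0) :
    ∃ ε > 0, ∀ (s : ℝ) (e : E), 0 < s → s < ε → dist e d < ε →
      dist (F.foot (s⁻¹ • e)) (F.foot x) < 1 := by
  obtain ⟨ε, hε, hne⟩ := hF.exists_dist_foot_ne_one hd hd0
  let η : ℝ := ε / (‖F.foot x‖ + 1)
  have hη : 0 < η := by positivity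
  have hηε : η ≤ ε := div_le_self hε.le (by linarith [norm_nonneg (F.foot x)])
  refine ⟨η, hη, fun s e hs hsη he => ?_⟩
  let S : Set (ℝ × E) := Ioo 0 η ×ˢ ball d ε
  have hS : IsPreconnected S := ((convex_Ioo 0 η).prod (convex_ball d ε)).isPreconnected
  have hcont : ContinuousOn (fun p : ℝ × E => dist (F.foot (p.1⁻¹ • p.2)) (F.foot x)) S := by
    refine (continuous_id.dist continuous_const).comp_continuousOn
      (F.continuous_foot.comp_continuousOn ?_)
    exact (continuousOn_fst.inv₀ fun p hp => hp.1.1.ne').smul continuousOn_snd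
  -- The point for this pair is `(η / 2)⁻¹ • d + F.foot x`; the choice of `η` puts its second entry
  -- within `ε` of `d`.
  have hp0 : (η / 2, d + (η / 2) • F.foot x) ∈ S := by
    refine ⟨⟨by positivity, by simpa using hη⟩, ?_⟩
    rw [mem_ball, dist_eq_norm, add_sub_cancel_left, norm_smul, Real.norm_eq_abs,
      abs_of_pos (by positivity)]
    have : η * (‖F.foot x‖ + 1) = ε := div_mul_cancel₀ _ (by positivity)
    nlinarith [norm_nonneg (F.foot x)]
  have hfoot : F.foot ((η / 2)⁻¹ • (d + (η / 2) • F.foot x)) = F.foot x := by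
    refine (F.eq_of_sub_foot_mem _ x ?_).2
    rw [smul_add, smul_smul, inv_mul_cancel₀ (by positivity), one_smul, add_sub_cancel_right]
    exact Submodule.smul_mem _ _ hd
  by_contra! hge
  obtain ⟨p, hp, hp1⟩ := hS.intermediate_value hp0
    (show (s, e) ∈ S from ⟨⟨hs, hsη⟩, he.trans_le hηε⟩) hcont
    (show (1 : ℝ) ∈ Icc _ _ from ⟨by simp only [hfoot, dist_self]; exact zero_le_one, hge⟩)
  exact hne p.1 p.2 hp.1.1 (hp.1.2.trans_le hηε) hp.2 hp1

theorem IsSkew.exists_finrank_eq_add_one_disjoint {k : ℕ} (hF : F.IsSkew)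
    (hk : ∀ x, finrank ℝ (F.dir x) = k) (hkE : k < finrank ℝ E) :
    ∃ V : Submodule ℝ E, finrank ℝ V = k + 1 ∧ ∀ x, V ⊓ F.dir x = ⊥ := by
  have h0 : F.dir 0 ≠ ⊤ := fun h => by
    have := hk 0
    rw [h, finrank_top] at this
    omega
  choose x hx using fun j : ℕ => F.exists_lt_norm_foot h0 (j + 1)
  let n : ℕ → E := fun j => ‖F.foot (x j)‖⁻¹ • F.foot (x j)
  have hpos : ∀ j, 0 < ‖F.foot (x j)‖ := fun j => by
    have : (0 : ℝ) ≤ j := Nat.cast_nonneg j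
    linarith [hx j]
  have hn1 : ∀ j, ‖n j‖ = 1 := fun j => by
    simp only [n]
    rw [norm_smul, norm_inv, norm_norm, inv_mul_cancel₀ (hpos j).ne']
  have hnorth : ∀ j, n j ∈ (F.dir (x j))ᗮ := fun j =>
    Submodule.smul_mem _ _ (F.foot_mem_orthogonal _)
  let K : ℕ → Submodule ℝ E := fun j => F.dir (x j) ⊔ Submodule.span ℝ {n j}
  have hn0 : ∀ j, n j ≠ 0 := fun j h => by simpa [h] using hn1 j
  have hKfin : ∀ j, finrank ℝ (K j) = k + 1 := fun j => by
    have hdisj : F.dir (x j) ⊓ Submodule.span ℝ {n j} = ⊥ := by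
      refine disjoint_iff.1 ((F.dir (x j)).orthogonal_disjoint.mono_right ?_)
      rw [Submodule.span_singleton_le_iff_mem]
      exact hnorth j
    have := Submodule.finrank_sup_add_finrank_inf_eq (F.dir (x j)) (Submodule.span ℝ {n j})
    rw [hdisj, finrank_bot, hk, finrank_span_singleton (hn0 j)] at this
    simpa using this
  have hKproj : ∀ j d, (K j).starProjection d =
      (F.dir (x j)).starProjection d + (inner ℝ (n j) d : ℝ) • n j := by
    intro j d
    refine Submodule.eq_starProjection_of_mem_orthogonal ?_ ?_
    · exact Submodule.add_mem_sup (Submodule.starProjection_apply_mem _ _)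
        (Submodule.smul_mem _ _ (Submodule.mem_span_singleton_self _))
    · have h1 : d - ((F.dir (x j)).starProjection d + (inner ℝ (n j) d : ℝ) • n j) ∈
          (F.dir (x j))ᗮ := by
        rw [← sub_sub]
        exact Submodule.sub_mem _ (Submodule.sub_starProjection_mem_orthogonal _)
          (Submodule.smul_mem _ _ (hnorth j))
      simp only [K]
      rw [← Submodule.inf_orthogonal]
      refine ⟨h1, ?_⟩
      rw [SetLike.mem_coe, Submodule.mem_orthogonal_singleton_iff_inner_right, inner_sub_right, inner_add_right,
        inner_smul_right, real_inner_self_eq_norm_sq, hn1,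
        Submodule.inner_left_of_mem_orthogonal (Submodule.starProjection_apply_mem _ _)
          (hnorth j)]
      ring
  have : ProperSpace (E →L[ℝ] E) := FiniteDimensional.proper ℝ _
  obtain ⟨⟨T, nlim⟩, -, φ, hφ, hlim⟩ := ((isCompact_closedBall (0 : E →L[ℝ] E) 1).prod
    (isCompact_closedBall (0 : E) 1)).tendsto_subseq (x := fun j => ((K j).starProjection, n j))
    fun j => ⟨by simpa using (K j).starProjection_norm_le, by simpa using (hn1 j).le⟩
  have hTlim : Tendsto (fun j => (K (φ j)).starProjection) atTop (𝓝 T) :=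
    (continuous_fst.tendsto _).comp hlim
  have hnlim : Tendsto (fun j => n (φ j)) atTop (𝓝 nlim) := (continuous_snd.tendsto _).comp hlim
  obtain ⟨V, hV, hVT⟩ := Submodule.exists_finrank_eq_of_tendsto_starProjection
    (fun j => hKfin (φ j)) hTlim
  refine ⟨V, hV, fun y => ?_⟩
  -- The coefficient `a j` below must be positive, which is why the sign matters; the other sign
  -- follows from `-d`.
  have main : ∀ d ∈ V, d ∈ F.dir y → 0 ≤ (inner ℝ nlim d : ℝ) → d = 0 := by
    intro d hdV hdy hdn
    by_contra hd0
    obtain ⟨ε, hε, hfoot⟩ := hF.exists_dist_foot_lt_one hdy hd0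
    have hinv : Tendsto (fun j => ‖F.foot (x (φ j))‖⁻¹) atTop (𝓝 0) := by
      refine (tendsto_inv_atTop_zero.comp ?_)
      refine tendsto_atTop_mono (fun j => ?_) (tendsto_natCast_atTop_atTop.comp hφ.tendsto_atTop)
      have := hx (φ j)
      simp only [Function.comp]
      linarith
    have hinner : Tendsto (fun j => |(inner ℝ (n (φ j)) d : ℝ)| + ‖F.foot (x (φ j))‖⁻¹) atTop
        (𝓝 (inner ℝ nlim d)) := by
      have := (hnlim.inner (tendsto_const_nhds (x := d))).abs.add hinv
      rwa [abs_of_nonneg hdn, add_zero] at this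
    -- Chosen so that `a j • F.foot (x (φ j))` tends to the `nlim` component of `d`. The absolute
    -- value and the extra inverse norm keep `a j` positive even if that component vanishes.
    let a : ℕ → ℝ := fun j =>
      ‖F.foot (x (φ j))‖⁻¹ * (|(inner ℝ (n (φ j)) d : ℝ)| + ‖F.foot (x (φ j))‖⁻¹)
    have hapos : ∀ j, 0 < a j := fun j => by
      have := hpos (φ j)
      positivity
    have ha : Tendsto a atTop (𝓝 0) := by simpa using hinv.mul hinner
    let e : ℕ → E := fun j => (F.dir (x (φ j))).starProjection d + a j • F.foot (x (φ j))
    have he : Tendsto e atTop (𝓝 d) := by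
      have h1 : Tendsto (fun j => (K (φ j)).starProjection d - (inner ℝ (n (φ j)) d : ℝ) • n (φ j) +
          (|(inner ℝ (n (φ j)) d : ℝ)| + ‖F.foot (x (φ j))‖⁻¹) • n (φ j)) atTop
          (𝓝 (T d - (inner ℝ nlim d : ℝ) • nlim + (inner ℝ nlim d : ℝ) • nlim)) :=
        (((((continuous_id.clm_apply continuous_const : Continuous fun S : E →L[ℝ] E => S d)).tendsto
          T).comp hTlim).sub
          ((hnlim.inner tendsto_const_nhds).smul hnlim)).add (hinner.smul hnlim)
      rw [sub_add_cancel, hVT d hdV] at h1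
      refine h1.congr fun j => ?_
      simp only [e, a, hKproj, add_sub_cancel_right, n, smul_smul]
      ring_nf
    obtain ⟨j, hja, hje, hjn⟩ := ((ha.eventually (gt_mem_nhds hε)).and
      ((he.eventually (ball_mem_nhds d hε)).and
        (hφ.tendsto_atTop.eventually (tendsto_natCast_atTop_atTop.eventually_ge_atTop
          (‖F.foot y‖))))).exists
    have hlt := hfoot (a j) (e j) (hapos j) hja hje
    -- Dividing by `a j` gives the foot of the remote fiber plus a vector of its direction.
    have hfe : F.foot ((a j)⁻¹ • e j) = F.foot (x (φ j)) := by
      refine (F.eq_of_sub_foot_mem _ _ ?_).2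
      simp only [e]
      rw [smul_add, smul_smul, inv_mul_cancel₀ (hapos j).ne', one_smul, add_sub_cancel_right]
      exact Submodule.smul_mem _ _ (Submodule.starProjection_apply_mem _ _)
    rw [hfe, dist_eq_norm] at hlt
    have h1 := norm_le_norm_add_norm_sub' (F.foot (x (φ j))) (F.foot y)
    have h2 := hx (φ j)
    linarith
  rw [Submodule.eq_bot_iff]
  rintro d ⟨hdV, hdy⟩
  rcases le_total 0 (inner ℝ nlim d : ℝ) with h | h
  · exact main d hdV hdy h
  · exact neg_eq_zero.1 (main (-d) (V.neg_mem hdV) (Submodule.neg_mem _ hdy)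
      (by rw [inner_neg_right]; linarith))

end OrthogonalFibration

end OrthogonalFibration

/-! ### From the oriented Grassmannian to orthogonal projections. -/

section Grassmannian

open ContinuousLinearMap in
theorem ContinuousLinearMap.starProjection_range_eq {G E : Type*} [NormedAddCommGroup G]
    [InnerProductSpace ℝ G] [FiniteDimensional ℝ G] [NormedAddCommGroup E] [InnerProductSpace ℝ E]
    [FiniteDimensional ℝ E] {A : G →L[ℝ] E} (hA : Function.Injective A) :
    IsUnit (adjoint A ∘L A) ∧
      A.range.starProjection = A ∘L Ring.inverse (adjoint A ∘L A) ∘L adjoint A := by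
  have hunit : IsUnit (adjoint A ∘L A) := by
    rw [ContinuousLinearMap.isUnit_iff_bijective]
    have hinj : Function.Injective (adjoint A ∘L A : G →L[ℝ] G) := by
      rw [injective_iff_map_eq_zero]
      intro c hc
      have h : inner ℝ (A c) (A c) = (0 : ℝ) := by
        rw [← adjoint_inner_left A]
        have : adjoint A (A c) = 0 := hc
        rw [this, inner_zero_left]
      exact hA (by rw [inner_self_eq_zero.1 h, map_zero])
    exact ⟨hinj, LinearMap.surjective_of_injective
      (f := ((adjoint A ∘L A : G →L[ℝ] G) : G →ₗ[ℝ] G)) hinj⟩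
  refine ⟨hunit, ContinuousLinearMap.ext fun x => ?_⟩
  refine Submodule.eq_starProjection_of_mem_orthogonal ⟨_, rfl⟩ ?_
  rw [Submodule.mem_orthogonal]
  rintro _ ⟨c, rfl⟩
  have h := congrArg (fun S : G →L[ℝ] G => S (adjoint A x)) (Ring.mul_inverse_cancel _ hunit)
  change inner ℝ (A c) (x - A (Ring.inverse (adjoint A ∘L A) (adjoint A x))) = 0
  rw [← adjoint_inner_right A, map_sub]
  change adjoint A (A (Ring.inverse (adjoint A ∘L A) (adjoint A x))) = adjoint A x at h
  rw [h, sub_self, inner_zero_right]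

namespace OrientedGrassmannian

open ContinuousLinearMap

/-- By the quotient topology it suffices to check frames. With `A f` the map sending coefficients to
combinations of the frame, the projection is `A (A* A)⁻¹ A*`, continuous in the frame. -/
theorem continuous_starProjection_plane (k n : ℕ) :
    Continuous fun P : OrientedGrassmannian k n => P.plane.starProjection := by
  refine continuous_coinduced_dom.2 ?_
  let A : Frame k n → EuclideanSpace ℝ (Fin k) →L[ℝ] EuclideanSpace ℝ (Fin n) := fun f =>
    ∑ i, (EuclideanSpace.proj i).smulRight (f.1 i)
  have hAapply : ∀ f c, A f c = ∑ i, c i • f.1 i := fun f c => by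
    simp [A, sum_apply]
  have hA : Continuous A := by
    refine continuous_finsetSum _ fun i _ => ?_
    exact (smulRightL ℝ (EuclideanSpace ℝ (Fin k)) (EuclideanSpace ℝ (Fin n))
      (EuclideanSpace.proj i)).continuous.comp ((continuous_apply i).comp continuous_subtype_val)
  have hinj : ∀ f, Function.Injective (A f) := fun f => by
    rw [injective_iff_map_eq_zero]
    intro c hc
    rw [hAapply] at hc
    ext i
    exact Fintype.linearIndependent_iff.1 f.2 c hc i
  have hrange : ∀ f, (ofFrame f).plane = (A f).range := fun f => by
    ext x
    change x ∈ Submodule.span ℝ (Set.range f.1) ↔ _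
    rw [Submodule.mem_span_range_iff_exists_fun]
    constructor
    · rintro ⟨c, hc⟩
      exact ⟨WithLp.toLp 2 c, by simpa [hAapply] using hc⟩
    · rintro ⟨c, hc⟩
      exact ⟨c, by rw [← hc]; exact (hAapply f c).symm⟩
  have hproj : ∀ f, (ofFrame f).plane.starProjection =
      A f ∘L Ring.inverse (adjoint (A f) ∘L A f) ∘L adjoint (A f) := fun f => by
    rw [← (starProjection_range_eq (hinj f)).2]
    congr 1
    exact hrange f
  have hadj : Continuous fun f => adjoint (A f) := (LinearIsometryEquiv.continuous _).comp hA
  have hinv : Continuous fun f => Ring.inverse (adjoint (A f) ∘L A f) := by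
    refine continuous_iff_continuousAt.2 fun f => ?_
    obtain ⟨U, hU⟩ := (starProjection_range_eq (hinj f)).1
    refine ContinuousAt.comp (g := Ring.inverse) ?_ (hadj.clm_comp hA).continuousAt
    rw [← hU]
    exact NormedRing.inverse_continuousAt U
  exact (hA.clm_comp (hinv.clm_comp hadj)).congr fun f => (hproj f).symm

end OrientedGrassmannian

namespace PlaneFibration

variable {k n : ℕ}

theorem mem_toAffineSubspace_iff (P : OrientedAffineGrassmannian k n)
    (x : EuclideanSpace ℝ (Fin n)) : x ∈ P.toAffineSubspace ↔ x - P.1.2 ∈ P.1.1.plane :=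
  AffineSubspace.mem_mk'

/-- The directions and nearest points of the fibers, without their orientation. -/
noncomputable def toOrthogonalFibration (F : PlaneFibration k n) :
    OrthogonalFibration (EuclideanSpace ℝ (Fin n)) where
  dir x := (F.fiber x).1.1.plane
  foot x := (F.fiber x).1.2
  continuous_starProjection := (OrientedGrassmannian.continuous_starProjection_plane k n).comp
    (continuous_fst.comp (continuous_subtype_val.comp F.continuous_fiber))
  continuous_foot := continuous_snd.comp (continuous_subtype_val.comp F.continuous_fiber)
  foot_mem_orthogonal x := (F.fiber x).2
  sub_foot_mem x := (mem_toAffineSubspace_iff _ _).1 (F.mem_fiber x)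
  eq_of_sub_foot_mem x y h := by
    have := F.fiber_unique x y ((mem_toAffineSubspace_iff _ _).2 h)
    rw [this]
    exact ⟨rfl, rfl⟩

theorem IsSkew.toOrthogonalFibration {F : PlaneFibration k n} (hF : F.IsSkew) :
    F.toOrthogonalFibration.IsSkew := by
  intro x y d hd0 hdx hdy
  by_contra hne
  have hfiber : F.fiber x ≠ F.fiber y := fun h => hne (by
    change (F.fiber x).1.2 = (F.fiber y).1.2
    rw [h])
  refine hF x y hfiber ⟨AffineSubspace.mk' (F.fiber x).1.2 (Submodule.span ℝ {d}),
    AffineSubspace.mk' (F.fiber y).1.2 (Submodule.span ℝ {d}), ?_, ?_, ?_, ?_, ?_⟩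
  · rw [AffineSubspace.direction_mk', finrank_span_singleton hd0]
  · rw [AffineSubspace.direction_mk', finrank_span_singleton hd0]
  · intro z hz
    exact (Submodule.span_singleton_le_iff_mem _ _).2 hdx hz
  · intro z hz
    exact (Submodule.span_singleton_le_iff_mem _ _).2 hdy hz
  · rw [AffineSubspace.parallel_iff_direction_eq_and_eq_bot_iff_eq_bot]
    refine ⟨by rw [AffineSubspace.direction_mk', AffineSubspace.direction_mk'], ?_⟩
    exact iff_of_false (AffineSubspace.nonempty_iff_ne_bot _ |>.1 (AffineSubspace.mk'_nonempty _ _))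
      (AffineSubspace.nonempty_iff_ne_bot _ |>.1 (AffineSubspace.mk'_nonempty _ _))

end PlaneFibration

end Grassmannian

theorem mainTheorem3 (k n : ℕ) (hkn : k < n) (F : PlaneFibration k n) (hF : F.IsSkew) :
    ∃ V : Submodule ℝ (EuclideanSpace ℝ (Fin n)), Module.finrank ℝ V = k + 1 ∧
      ∀ x, AreTransverse V.toAffineSubspace (F.fiber x).toAffineSubspace := by
  obtain ⟨V, hV, hdisj⟩ := hF.toOrthogonalFibration.exists_finrank_eq_add_one_disjoint
    (fun x => (F.fiber x).1.1.finrank_plane) (by simpa using hkn)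
  refine ⟨V, hV, fun x => ?_⟩
  rw [AreTransverse, OrientedAffineGrassmannian.toAffineSubspace, AffineSubspace.direction_mk',
    Submodule.toAffineSubspace_direction]
  exact hdisj x
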